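/- Let $n$ be a natural number; $C_c^\infty(\mathbb{R}^n;\mathbb{R}^n)$ denotes the smooth compactly supported vector fields on $\mathbb{R}^n$. For $\alpha\in(0,1)$ put $$\mu_{n,\alpha}:=2^{\alpha}\pi^{-\frac n2}\,\frac{\Gamma\left(\frac{n+\alpha+1}{2}\right)}{\Gamma\left(\frac{1-\alpha}{2}\right)},\qquad \operatorname{div}^\alpha\varphi(x):=\mu_{n,\alpha}\int_{\mathbb{R}^n}\frac{(y-x)\cdot(\varphi(y)-\varphi(x))}{|y-x|^{n+\alpha+1}}\,dy$$ for $\varphi\in C_c^\infty(\mathbb{R}^n;\mathbb{R}^n)$ and $x\in\mathbb{R}^n$. For $f\in L^\infty(\mathbb{R}^n)$, the weak gradient $\nabla_w f$ and the weak fractional $\alpha$-gradient $\nabla^\alpha_w f$ are, when they exist, the fields in $L^1_{\mathrm{loc}}(\mathbb{R}^n;\mathbb{R}^n)$ (unique up to a.e. equality) such that, for all $\varphi\in C_c^\infty(\mathbb{R}^n;\mathbb{R}^n)$, $$\int_{\mathbb{R}^n} f\,\operatorname{div}\varphi\,dx=-\int_{\mathbb{R}^n}\nabla_w f\cdot\varphi\,dx,\qquad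 \int_{\mathbb{R}^n} f\,\operatorname{div}^\alpha\varphi\,dx=-\int_{\mathbb{R}^n}\nabla^\alpha_w f\cdot\varphi\,dx .$$ Let $W^{1,\infty}(\mathbb{R}^n)$, respectively $S^{\alpha,\infty}(\mathbb{R}^n)$, be the space of all $f\in L^\infty(\mathbb{R}^n)$ for which $\nabla_w f$, respectively $\nabla^\alpha_w f$, exists and belongs to $L^\infty(\mathbb{R}^n;\mathbb{R}^n)$. **Theorem.** If $f\in W^{1,\infty}(\mathbb{R}^n)$, then $f\in S^{\alpha,\infty}(\mathbb{R}^n)$ for every $\alpha\in(0,1)$, and $\nabla^\alpha_w f$ converges weakly* to $\nabla_w f$ in $L^\infty(\mathbb{R}^n;\mathbb{R}^n)$ as $\alpha\to1^-$, that is, $$\lim_{\alpha\to1^-}\int_{\mathbb{R}^n}\nabla^\alpha_w f\cdot\varphi\,dx=\int_{\mathbb{R}^n}\nabla_w f\cdot\varphi\,dx\qquad\text{for all }\varphi\in L^1(\mathbb{R}^n;\mathbb{R}^n).$$ Moreover, $$\|\nabla_w f\|_{L^\infty(\mathbb{R}^n;\mathbb{R}^n)}\le\liminf_{\alpha\to1^-}\|\nabla^\alpha_w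 f\|_{L^\infty(\mathbb{R}^n;\mathbb{R}^n)} .$$ -/

import Mathlib

open MeasureTheory Filter Topology
open scoped ENNReal ContDiff InnerProductSpace

namespace FracSobolev

/-- `ℝⁿ` with its Euclidean norm, inner product and Lebesgue measure. -/
abbrev E (n : ℕ) : Type := EuclideanSpace ℝ (Fin n)

/-- Test vector fields: `φ ∈ C_c^∞(ℝⁿ; ℝⁿ)`. -/
def IsTestField {n : ℕ} (φ : E n → E n) : Prop :=
  ContDiff ℝ ∞ φ ∧ HasCompactSupport φ

/-- The classical divergence `∑ᵢ ∂ᵢ φᵢ`. -/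
noncomputable def div {n : ℕ} (φ : E n → E n) (x : E n) : ℝ :=
  ∑ i : Fin n, (fderiv ℝ φ x (EuclideanSpace.single i 1)) i

/-- The constant
`μ_{n,α} = 2^α π^(-n/2) Γ((n + α + 1)/2) / Γ((1 - α)/2)`. -/
noncomputable def mu (n : ℕ) (α : ℝ) : ℝ :=
  (2 : ℝ) ^ α * Real.pi ^ (-(n : ℝ) / 2) *
    (Real.Gamma (((n : ℝ) + α + 1) / 2) / Real.Gamma ((1 - α) / 2))

/-- The fractional `α`-divergence
`div^α φ(x) = μ_{n,α} ∫ (y - x) · (φ(y) - φ(x)) / |y - x|^(n + α + 1) dy`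
(the integral converges absolutely for test fields when `0 < α < 1`). -/
noncomputable def fracDiv {n : ℕ} (α : ℝ) (φ : E n → E n) (x : E n) : ℝ :=
  mu n α * ∫ y : E n, ⟪y - x, φ y - φ x⟫_ℝ / ‖y - x‖ ^ ((n : ℝ) + α + 1)

/-- `g ∈ L¹_loc(ℝⁿ; ℝⁿ)` is (a representative of) the weak gradient `∇_w f`. -/
def HasWeakGrad {n : ℕ} (f : E n → ℝ) (g : E n → E n) : Prop :=
  LocallyIntegrable g volume ∧
    ∀ φ : E n → E n, IsTestField φ →
      ∫ x, f x * div φ x = -∫ x, ⟪g x, φ x⟫_ℝ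

/-- `g ∈ L¹_loc(ℝⁿ; ℝⁿ)` is (a representative of) the weak fractional `α`-gradient `∇^α_w f`. -/
def HasWeakFracGrad {n : ℕ} (α : ℝ) (f : E n → ℝ) (g : E n → E n) : Prop :=
  LocallyIntegrable g volume ∧
    ∀ φ : E n → E n, IsTestField φ →
      ∫ x, f x * fracDiv α φ x = -∫ x, ⟪g x, φ x⟫_ℝ

/-- The Sobolev space `W^{1,p}(ℝⁿ)`. -/
def MemW1 {n : ℕ} (p : ℝ≥0∞) (f : E n → ℝ) : Prop :=
  MemLp f p volume ∧ ∃ g : E n → E n, HasWeakGrad f g ∧ MemLp g p volume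

/-- The distributional fractional Sobolev space `S^{α,p}(ℝⁿ)`. -/
def MemS {n : ℕ} (α : ℝ) (p : ℝ≥0∞) (f : E n → ℝ) : Prop :=
  MemLp f p volume ∧ ∃ g : E n → E n, HasWeakFracGrad α f g ∧ MemLp g p volume

/-- Weak* convergence in `L^∞(ℝⁿ; ℝⁿ)` of `G a` to `g` along the filter `l`: the fields lie in
`L^∞` (those `G a` with `a` near the limit) and
`∫ G a · φ → ∫ g · φ` for every `φ ∈ L¹(ℝⁿ; ℝⁿ)`. -/
def TendstoWeakStarLInfty {n : ℕ} (G : ℝ → E n → E n) (l : Filter ℝ) (g : E n → E n) : Prop :=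
  (∀ᶠ a in l, MemLp (G a) ∞ volume) ∧ MemLp g ∞ volume ∧
    ∀ φ : E n → E n, MemLp φ 1 volume →
      Tendsto (fun a => ∫ x, ⟪G a x, φ x⟫_ℝ) l (𝓝 (∫ x, ⟪g x, φ x⟫_ℝ))

end FracSobolev

/-! Let `A` bound both `f` and its weak gradient `g`. Then `|f (x + h) - f x| ≤ 2 A min(1, |h|)`
almost everywhere, so `μ ∫ (f(x+h) - f(x)) h / |h|^(n+α+1) dh` converges absolutely for almost every
`x` and defines a bounded field. Fubini and a translation, which moves the difference from the test
field to `f`, show that this field (`fracGrad`) is the weak fractional gradient.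

Paired with `φ ∈ L¹`, it equals `μ ∫ D(h) / |h|^(n+α+1) dh`, where `D = diffPairing f φ`. Since
`f(x+h) - f(x) = ∫₀¹ g(x+th)·h dt` almost everywhere and translations are continuous in `L¹`, `D(h)
= ∑ M i j h i h j + o(|h|²)` with `M i j = ∫ g i φ j`. As `α → 1`, `μ` behaves like `(1-α)/|B|`,
with `B` the unit ball, while the second moments of the kernel on `B` are `δ i j |B|/(1-α)`. The
weighted kernel thus concentrates at the origin and selects the trace of `M`, which is `∫ g·φ`
(`tendsto_mu_mul_integral`, `IsBddGradPair.tendsto_integral_fracGrad`).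

The expansion holds for every `φ ∈ L¹`, so no density argument is needed. The norm inequality is
weak* lower semicontinuity, by duality with `L¹`. -/

namespace FracSobolev

/-! ### The kernel in polar coordinates -/

/-- The kernel `min(1, |h|) |h| / |h|^(n + α + 1)`, which dominates the fractional difference
quotients of bounded Lipschitz functions. -/
noncomputable def kern (n : ℕ) (α : ℝ) (h : E n) : ℝ :=
  min 1 ‖h‖ * ‖h‖ / ‖h‖ ^ ((n : ℝ) + α + 1)

theorem kern_nonneg (n : ℕ) (α : ℝ) (h : E n) : 0 ≤ kern n α h := by
  unfold kern; positivity

/-- The factor `y ^ (n - 1)` is the Jacobian of polar coordinates; `n ≠ 0` makes the natural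
subtraction genuine. -/
theorem radial_near {n : ℕ} (hn : n ≠ 0) {α y : ℝ} (hy : 0 < y) :
    y ^ (n - 1) * (y * y / y ^ ((n : ℝ) + α + 1)) = y ^ (-α) := by
  have h1 : y ^ (n - 1) = y ^ ((n : ℝ) - 1) := by
    rw [← Real.rpow_natCast, Nat.cast_sub (Nat.one_le_iff_ne_zero.2 hn)]; simp
  have h2 : y * y = y ^ (2 : ℝ) := by
    rw [Real.rpow_two]; ring
  rw [h1, h2, ← Real.rpow_sub hy, ← Real.rpow_add hy]
  congr 1; ring

theorem radial_far {n : ℕ} (hn : n ≠ 0) {α y : ℝ} (hy : 0 < y) :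
    y ^ (n - 1) * (y / y ^ ((n : ℝ) + α + 1)) = y ^ (-α - 1) := by
  have h1 : y ^ (n - 1) = y ^ ((n : ℝ) - 1) := by
    rw [← Real.rpow_natCast, Nat.cast_sub (Nat.one_le_iff_ne_zero.2 hn)]; simp
  have h2 : y / y ^ ((n : ℝ) + α + 1) = y ^ (1 - ((n : ℝ) + α + 1)) := by
    rw [Real.rpow_sub hy, Real.rpow_one]
  rw [h1, h2, ← Real.rpow_add hy]
  congr 1; ring

theorem integrableOn_rpow_neg {α : ℝ} (hα1 : α < 1) :
    IntegrableOn (fun y : ℝ => y ^ (-α)) (Set.Ioc 0 1) := by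
  rw [← intervalIntegrable_iff_integrableOn_Ioc_of_le zero_le_one]
  exact intervalIntegral.intervalIntegrable_rpow' (by linarith)

theorem integral_rpow_neg {α : ℝ} (hα1 : α < 1) :
    ∫ y in Set.Ioc (0 : ℝ) 1, y ^ (-α) = 1 / (1 - α) := by
  rw [← intervalIntegral.integral_of_le zero_le_one, integral_rpow (Or.inl (by linarith))]
  rw [Real.one_rpow, Real.zero_rpow (by linarith)]
  congr 1 <;> ring

theorem nontrivial_E {n : ℕ} (hn : n ≠ 0) : Nontrivial (E n) := by
  have : NeZero n := ⟨hn⟩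
  infer_instance

/-- The surface measure of the unit sphere. -/
noncomputable def sphereArea (n : ℕ) : ℝ := n * volume.real (Metric.ball (0 : E n) 1)

theorem kern_radial_Ioc {n : ℕ} (hn : n ≠ 0) {α y : ℝ} (hy : y ∈ Set.Ioc (0 : ℝ) 1) :
    y ^ (n - 1) * (min 1 y * y / y ^ ((n : ℝ) + α + 1)) = y ^ (-α) := by
  rw [min_eq_right hy.2, radial_near hn hy.1]

theorem kern_radial_Ioi {n : ℕ} (hn : n ≠ 0) {α y : ℝ} (hy : y ∈ Set.Ioi (1 : ℝ)) :
    y ^ (n - 1) * (min 1 y * y / y ^ ((n : ℝ) + α + 1)) = y ^ (-α - 1) := by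
  rw [min_eq_left (le_of_lt hy), one_mul, radial_far hn (zero_lt_one.trans hy)]

/-- Polar coordinates split at radius one, where the minimum switches. The inner part needs `α < 1`
and has radial mass `1/(1-α)`, the outer part needs `0 < α` and has radial mass `1/α`. Only the
inner mass blows up as `α → 1`. -/
theorem integrable_kern {n : ℕ} (hn : n ≠ 0) {α : ℝ} (hα : α ∈ Set.Ioo (0 : ℝ) 1) :
    Integrable (kern n α) ∧
      ∫ h, kern n α h = sphereArea n * (1 / (1 - α) + 1 / α) := by
  have := nontrivial_E hn
  let k : ℝ → ℝ := fun y => min 1 y * y / y ^ ((n : ℝ) + α + 1)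
  have hk : kern n α = fun h : E n => k ‖h‖ := rfl
  have e1 : Set.EqOn (fun y : ℝ => y ^ (-α)) (fun y => y ^ (n - 1) • k y) (Set.Ioc 0 1) :=
    fun y hy => (kern_radial_Ioc hn hy).symm
  have e2 : Set.EqOn (fun y : ℝ => y ^ (-α - 1)) (fun y => y ^ (n - 1) • k y) (Set.Ioi 1) :=
    fun y hy => (kern_radial_Ioi hn hy).symm
  have i1 : IntegrableOn (fun y : ℝ => y ^ (n - 1) • k y) (Set.Ioc 0 1) :=
    (integrableOn_rpow_neg hα.2).congr_fun e1 measurableSet_Ioc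
  have i2 : IntegrableOn (fun y : ℝ => y ^ (n - 1) • k y) (Set.Ioi 1) :=
    (integrableOn_Ioi_rpow_of_lt (by linarith [hα.1]) zero_lt_one).congr_fun e2 measurableSet_Ioi
  have hu : Set.Ioc (0 : ℝ) 1 ∪ Set.Ioi 1 = Set.Ioi 0 := Set.Ioc_union_Ioi_eq_Ioi zero_le_one
  constructor
  · rw [hk, integrable_fun_norm_addHaar (volume : Measure (E n)) (f := k)]
    simp only [finrank_euclideanSpace, Fintype.card_fin]
    rw [← hu]; exact i1.union i2
  · rw [hk, integral_fun_norm_addHaar (volume : Measure (E n)) k]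
    simp only [finrank_euclideanSpace, Fintype.card_fin]
    rw [← hu, setIntegral_union (Set.Ioc_disjoint_Ioi le_rfl) measurableSet_Ioi i1 i2,
      ← setIntegral_congr_fun measurableSet_Ioc e1, ← setIntegral_congr_fun measurableSet_Ioi e2,
      integral_rpow_neg hα.2, integral_Ioi_rpow_of_lt (by linarith [hα.1]) zero_lt_one]
    simp only [sphereArea, Real.one_rpow, nsmul_eq_mul, smul_eq_mul]
    rw [mul_assoc]
    congr 3
    rw [show -α - 1 + 1 = -α by ring, neg_div_neg_eq]

theorem integral_ball_kernel {n : ℕ} (hn : n ≠ 0) {α : ℝ} (hα1 : α < 1) :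
    ∫ h in Metric.ball (0 : E n) 1, ‖h‖ * ‖h‖ / ‖h‖ ^ ((n : ℝ) + α + 1) =
      sphereArea n / (1 - α) := by
  have := nontrivial_E hn
  let k : ℝ → ℝ := (Set.Iio 1).indicator fun y => y * y / y ^ ((n : ℝ) + α + 1)
  have hk : (Metric.ball (0 : E n) 1).indicator
      (fun h => ‖h‖ * ‖h‖ / ‖h‖ ^ ((n : ℝ) + α + 1)) = fun h : E n => k ‖h‖ := by
    ext h; simp [k, Set.indicator]
  rw [← integral_indicator measurableSet_ball, hk,
    integral_fun_norm_addHaar (volume : Measure (E n)) k]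
  simp only [finrank_euclideanSpace, Fintype.card_fin]
  have : ∫ y in Set.Ioi (0 : ℝ), y ^ (n - 1) • k y = 1 / (1 - α) := by
    rw [← integral_rpow_neg hα1, integral_Ioc_eq_integral_Ioo, ← Set.Ioi_inter_Iio,
      ← setIntegral_indicator measurableSet_Iio]
    refine setIntegral_congr_fun measurableSet_Ioi fun y hy => ?_
    by_cases h1 : y < 1
    · simp [k, h1, ← radial_near hn (Set.mem_Ioi.1 hy)]
    · simp [k, h1]
  rw [this, nsmul_eq_mul, smul_eq_mul, sphereArea]
  ring

/-! ### Asymptotics of the constant as `α → 1` -/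

/-- The recurrence `Γ(s+1) = s Γ(s)` at `s = (1-α)/2` isolates the simple zero of `μ` at `α = 1`;
the remaining factor is continuous there. -/
theorem mu_eq {α : ℝ} (n : ℕ) (hα1 : α < 1) :
    mu n α = (1 - α) * ((2 : ℝ) ^ α * Real.pi ^ (-(n : ℝ) / 2) *
      (Real.Gamma (((n : ℝ) + α + 1) / 2) / (2 * Real.Gamma ((1 - α) / 2 + 1)))) := by
  have h0 : (1 - α) / 2 ≠ 0 := by linarith
  have hG : Real.Gamma ((1 - α) / 2) ≠ 0 := (Real.Gamma_pos_of_pos (by linarith)).ne'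
  rw [mu, Real.Gamma_add_one h0]
  have : (1 - α) ≠ 0 := by linarith
  field_simp

theorem tendsto_mu_div {n : ℕ} (hn : n ≠ 0) :
    Tendsto (fun α => mu n α / (1 - α)) (𝓝[<] (1 : ℝ))
      (𝓝 (volume.real (Metric.ball (0 : E n) 1))⁻¹) := by
  have hv : (volume.real (Metric.ball (0 : E n) 1))⁻¹ =
      (2 : ℝ) ^ (1 : ℝ) * Real.pi ^ (-(n : ℝ) / 2) *
      (Real.Gamma (((n : ℝ) + 1 + 1) / 2) / (2 * Real.Gamma ((1 - 1) / 2 + 1))) := by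
    have : Nonempty (Fin n) := Fin.pos_iff_nonempty.1 (Nat.pos_of_ne_zero hn)
    have hG : 0 < Real.Gamma ((n : ℝ) / 2 + 1) := Real.Gamma_pos_of_pos (by positivity)
    rw [Measure.real, EuclideanSpace.volume_ball]
    simp only [Fintype.card_fin, ENNReal.ofReal_one, one_pow, one_mul]
    rw [ENNReal.toReal_ofReal (by positivity)]
    have h1 : √Real.pi ^ n = Real.pi ^ ((n : ℝ) / 2) := by
      rw [Real.sqrt_eq_rpow, ← Real.rpow_natCast, ← Real.rpow_mul Real.pi_pos.le]
      congr 1; ring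
    have h2 : Real.pi ^ (-(n : ℝ) / 2) = (Real.pi ^ ((n : ℝ) / 2))⁻¹ := by
      rw [neg_div, Real.rpow_neg Real.pi_pos.le]
    have h3 : ((n : ℝ) + 1 + 1) / 2 = (n : ℝ) / 2 + 1 := by ring
    rw [h1, h2, h3, inv_div]
    simp only [Real.rpow_one, sub_self, zero_div, zero_add, Real.Gamma_one, mul_one]
    ring
  rw [hv]
  have hc : ContinuousAt (fun α : ℝ => (2 : ℝ) ^ α * Real.pi ^ (-(n : ℝ) / 2) *
      (Real.Gamma (((n : ℝ) + α + 1) / 2) / (2 * Real.Gamma ((1 - α) / 2 + 1)))) 1 := by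
    have g1 : ContinuousAt (fun α : ℝ => Real.Gamma (((n : ℝ) + α + 1) / 2)) 1 :=
      ContinuousAt.comp (g := Real.Gamma)
        (Real.differentiableOn_Gamma_Ioi.differentiableAt
          (Ioi_mem_nhds (by positivity))).continuousAt (by fun_prop)
    have g2 : ContinuousAt (fun α : ℝ => Real.Gamma ((1 - α) / 2 + 1)) 1 :=
      ContinuousAt.comp (g := Real.Gamma)
        (Real.differentiableOn_Gamma_Ioi.differentiableAt
          (Ioi_mem_nhds (by norm_num))).continuousAt (by fun_prop)
    have p : ContinuousAt (fun α : ℝ => (2 : ℝ) ^ α) 1 :=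
      (Real.continuous_const_rpow two_ne_zero).continuousAt
    refine (p.mul continuousAt_const).mul (g1.div (continuousAt_const.mul g2) ?_)
    simp
  refine (hc.tendsto.mono_left nhdsWithin_le_nhds).congr' ?_
  filter_upwards [self_mem_nhdsWithin] with α hα
  have : (1 - α) ≠ 0 := by linarith [Set.mem_Iio.1 hα]
  rw [mu_eq n hα]
  field_simp

theorem tendsto_mu {n : ℕ} (hn : n ≠ 0) : Tendsto (mu n) (𝓝[<] (1 : ℝ)) (𝓝 0) := by
  have h1 : Tendsto (fun α : ℝ => 1 - α) (𝓝[<] 1) (𝓝 0) := by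
    have : Tendsto (fun α : ℝ => 1 - α) (𝓝 1) (𝓝 (1 - 1)) :=
      (continuous_const.sub continuous_id).tendsto 1
    rw [sub_self] at this
    exact this.mono_left nhdsWithin_le_nhds
  have := (tendsto_mu_div hn).mul h1
  rw [mul_zero] at this
  refine this.congr' ?_
  filter_upwards [self_mem_nhdsWithin] with α hα
  have : (1 - α) ≠ 0 := by linarith [Set.mem_Iio.1 hα]
  field_simp

theorem mu_nonneg (n : ℕ) {α : ℝ} (hα : α ∈ Set.Ioo (0 : ℝ) 1) : 0 ≤ mu n α := by
  have h1 : 0 < Real.Gamma (((n : ℝ) + α + 1) / 2) :=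
    Real.Gamma_pos_of_pos (by have := hα.1; positivity)
  have h2 : 0 < Real.Gamma ((1 - α) / 2) := Real.Gamma_pos_of_pos (by linarith [hα.2])
  unfold mu; positivity

/-! ### Second moments of the kernel on the unit ball -/

theorem setIntegral_ball_comp_isometry {n : ℕ} (L : E n ≃ₗᵢ[ℝ] E n) (F : E n → ℝ) :
    ∫ h in Metric.ball (0 : E n) 1, F (L h) = ∫ h in Metric.ball (0 : E n) 1, F h := by
  have h := L.measurePreserving.setIntegral_preimage_emb
    L.toHomeomorph.measurableEmbedding F (Metric.ball 0 1)
  rw [← h]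
  congr 2
  ext x; simp

theorem abs_coord_le {n : ℕ} (h : E n) (i : Fin n) : |h i| ≤ ‖h‖ := by
  simpa using PiLp.norm_apply_le h i

theorem integrableOn_ball_coord_mul {n : ℕ} (hn : n ≠ 0) {α : ℝ} (hα : α ∈ Set.Ioo (0 : ℝ) 1)
    (i j : Fin n) :
    IntegrableOn (fun h : E n => h i * h j / ‖h‖ ^ ((n : ℝ) + α + 1)) (Metric.ball 0 1) := by
  refine Integrable.mono' (integrable_kern hn hα).1.integrableOn
    (Measurable.aestronglyMeasurable (by fun_prop)) ?_
  filter_upwards [ae_restrict_mem measurableSet_ball] with h hh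
  rw [mem_ball_zero_iff] at hh
  rw [Real.norm_eq_abs, abs_div, abs_mul, abs_of_nonneg (Real.rpow_nonneg (norm_nonneg h) _), kern,
    min_eq_right hh.le]
  gcongr <;> exact abs_coord_le _ _

/-- The integrand is odd under reflection of the `i`-th coordinate. -/
theorem setIntegral_ball_coord_mul_of_ne {n : ℕ} (α : ℝ) {i j : Fin n} (hij : i ≠ j) :
    ∫ h in Metric.ball (0 : E n) 1, h i * h j / ‖h‖ ^ ((n : ℝ) + α + 1) = 0 := by
  let L : E n ≃ₗᵢ[ℝ] E n := LinearIsometryEquiv.piLpCongrRight 2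
    (fun k => if k = i then LinearIsometryEquiv.neg ℝ else LinearIsometryEquiv.refl ℝ ℝ)
  have h := setIntegral_ball_comp_isometry L fun h => h i * h j / ‖h‖ ^ ((n : ℝ) + α + 1)
  have hL : ∀ h : E n, (L h) i * (L h) j / ‖L h‖ ^ ((n : ℝ) + α + 1) =
      -(h i * h j / ‖h‖ ^ ((n : ℝ) + α + 1)) := by
    intro h
    rw [L.norm_map]
    simp [L, LinearIsometryEquiv.piLpCongrRight_apply, hij.symm, neg_div]
  simp_rw [hL, integral_neg] at h
  linarith

/-- Swapping coordinates shows that the `n` diagonal moments agree, and their sum is the radial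
integral `integral_ball_kernel`. -/
theorem setIntegral_ball_coord_sq {n : ℕ} (hn : n ≠ 0) {α : ℝ} (hα : α ∈ Set.Ioo (0 : ℝ) 1)
    (i : Fin n) :
    ∫ h in Metric.ball (0 : E n) 1, h i * h i / ‖h‖ ^ ((n : ℝ) + α + 1) =
      volume.real (Metric.ball (0 : E n) 1) / (1 - α) := by
  have hsymm : ∀ j : Fin n,
      ∫ h in Metric.ball (0 : E n) 1, h j * h j / ‖h‖ ^ ((n : ℝ) + α + 1) =
      ∫ h in Metric.ball (0 : E n) 1, h i * h i / ‖h‖ ^ ((n : ℝ) + α + 1) := by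
    intro j
    let L : E n ≃ₗᵢ[ℝ] E n := LinearIsometryEquiv.piLpCongrLeft 2 ℝ ℝ (Equiv.swap i j)
    have h := setIntegral_ball_comp_isometry L fun h => h i * h i / ‖h‖ ^ ((n : ℝ) + α + 1)
    rw [← h]
    refine integral_congr_ae (Eventually.of_forall fun x => ?_)
    simp only [L.norm_map]
    simp [L, LinearIsometryEquiv.piLpCongrLeft_apply, Equiv.piCongrLeft'_apply]
  have hsum := integral_ball_kernel hn hα.2
  have hexp : ∀ h : E n, ‖h‖ * ‖h‖ / ‖h‖ ^ ((n : ℝ) + α + 1) =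
      ∑ j : Fin n, h j * h j / ‖h‖ ^ ((n : ℝ) + α + 1) := by
    intro h
    rw [← Finset.sum_div, ← real_inner_self_eq_norm_mul_norm, PiLp.inner_apply]
    simp [sq]
  simp_rw [hexp] at hsum
  rw [integral_finsetSum _ fun j _ => integrableOn_ball_coord_mul hn hα j j,
    Finset.sum_congr rfl fun j _ => hsymm j] at hsum
  simp only [Finset.sum_const, Finset.card_univ, Fintype.card_fin, nsmul_eq_mul, sphereArea] at hsum
  have : (n : ℝ) ≠ 0 := Nat.cast_ne_zero.2 hn
  rw [mul_div_assoc] at hsum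
  exact mul_left_cancel₀ this hsum

/-! ### Concentration of the weighted kernel at the origin -/

theorem Ioo_mem_nhdsLT_one {a : ℝ} (ha : a < 1) : ∀ᶠ α : ℝ in 𝓝[<] (1 : ℝ), α ∈ Set.Ioo a 1 :=
  Ioo_mem_nhdsLT ha

theorem volume_real_ball_pos (n : ℕ) : 0 < volume.real (Metric.ball (0 : E n) 1) :=
  ENNReal.toReal_pos (Metric.measure_ball_pos _ _ one_pos).ne' measure_ball_lt_top.ne

theorem tendsto_mu_mul_quadratic {n : ℕ} (hn : n ≠ 0) (M : Fin n → Fin n → ℝ) :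
    Tendsto (fun α => mu n α * ∫ h in Metric.ball (0 : E n) 1,
      (∑ i, ∑ j, M i j * (h i * h j)) / ‖h‖ ^ ((n : ℝ) + α + 1)) (𝓝[<] (1 : ℝ))
      (𝓝 (∑ i, M i i)) := by
  have hv := (volume_real_ball_pos n).ne'
  have h1 := ((tendsto_mu_div hn).mul_const (volume.real (Metric.ball (0 : E n) 1))).mul_const
    (∑ i, M i i)
  rw [inv_mul_cancel₀ hv, one_mul] at h1
  refine h1.congr' ?_
  filter_upwards [Ioo_mem_nhdsLT_one zero_lt_one] with α hα
  have hexp : ∀ h : E n, (∑ i, ∑ j, M i j * (h i * h j)) / ‖h‖ ^ ((n : ℝ) + α + 1) =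
      ∑ i, ∑ j, M i j * (h i * h j / ‖h‖ ^ ((n : ℝ) + α + 1)) := by
    intro h
    simp_rw [Finset.sum_div, mul_div_assoc]
  have hint : ∀ i j, IntegrableOn
      (fun h : E n => M i j * (h i * h j / ‖h‖ ^ ((n : ℝ) + α + 1))) (Metric.ball 0 1) :=
    fun i j => (integrableOn_ball_coord_mul hn hα i j).const_mul _
  simp_rw [hexp]
  rw [integral_finsetSum _ fun i _ => integrable_finsetSum _ fun j _ => hint i j]
  have : ∀ i, ∫ h in Metric.ball (0 : E n) 1,
      ∑ j, M i j * (h i * h j / ‖h‖ ^ ((n : ℝ) + α + 1)) =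
      M i i * (volume.real (Metric.ball (0 : E n) 1) / (1 - α)) := by
    intro i
    rw [integral_finsetSum _ fun j _ => hint i j]
    simp_rw [integral_const_mul]
    rw [Finset.sum_eq_single i, setIntegral_ball_coord_sq hn hα]
    · intro j _ hj
      rw [setIntegral_ball_coord_mul_of_ne α hj.symm, mul_zero]
    · simp
  simp_rw [this, ← Finset.sum_mul]
  ring

theorem tendsto_mu_mul_integral_kern {n : ℕ} (hn : n ≠ 0) :
    Tendsto (fun α => mu n α * ∫ h, kern n α h) (𝓝[<] (1 : ℝ)) (𝓝 n) := by
  have hv := (volume_real_ball_pos n).ne'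
  have h3 : Tendsto (fun α : ℝ => 1 / α) (𝓝[<] (1 : ℝ)) (𝓝 (1 / 1)) :=
    ((continuousAt_const.div continuousAt_id one_ne_zero).tendsto).mono_left nhdsWithin_le_nhds
  have h1 := ((tendsto_mu_div hn).mul_const (sphereArea n)).add
    (((tendsto_mu hn).mul_const (sphereArea n)).mul h3)
  have : (volume.real (Metric.ball (0 : E n) 1))⁻¹ * sphereArea n + 0 * sphereArea n * (1 / 1)
      = n := by
    rw [sphereArea]; field_simp; ring
  rw [this] at h1
  refine h1.congr' ?_
  filter_upwards [Ioo_mem_nhdsLT_one zero_lt_one] with α hα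
  rw [(integrable_kern hn hα).2]
  ring

/-- Away from the origin the kernels are dominated uniformly in `α` by one integrable function, so
the factor `μ → 0` removes their contribution. -/
theorem kern_le_of_le_norm {n : ℕ} {α δ : ℝ} (hα : α ∈ Set.Ioo (1 / 2 : ℝ) 1) (hδ : 0 < δ)
    (hδ1 : δ ≤ 1) {h : E n} (hh : δ ≤ ‖h‖) : kern n α h ≤ δ⁻¹ * kern n (1 / 2) h := by
  have hp : 0 < ‖h‖ := hδ.trans_le hh
  have h1 : ‖h‖ ^ ((n : ℝ) + α + 1) = ‖h‖ ^ ((n : ℝ) + 1 / 2 + 1) * ‖h‖ ^ (α - 1 / 2) := by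
    rw [← Real.rpow_add hp]; congr 1; ring
  have h2 : δ ≤ ‖h‖ ^ (α - 1 / 2) :=
    calc δ = δ ^ (1 : ℝ) := (Real.rpow_one δ).symm
      _ ≤ δ ^ (α - 1 / 2) := Real.rpow_le_rpow_of_exponent_ge hδ hδ1 (by linarith [hα.2])
      _ ≤ _ := Real.rpow_le_rpow hδ.le hh (by linarith [hα.1])
  unfold kern
  rw [h1, ← div_div, div_eq_inv_mul _ (‖h‖ ^ (α - 1 / 2))]
  gcongr

theorem tendsto_mu_mul_integral_zero {n : ℕ} (hn : n ≠ 0) {R : E n → ℝ} {C : ℝ}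
    (hR : ∀ h, |R h| ≤ C * (min 1 ‖h‖ * ‖h‖))
    (hR0 : ∀ ε > 0, ∃ δ > 0, ∀ h, ‖h‖ < δ → |R h| ≤ ε * (‖h‖ * ‖h‖)) :
    Tendsto (fun α => mu n α * ∫ h, R h / ‖h‖ ^ ((n : ℝ) + α + 1)) (𝓝[<] (1 : ℝ)) (𝓝 0) := by
  rw [Metric.tendsto_nhds]
  intro ε hε
  have hn' : (0 : ℝ) < n := Nat.cast_pos.2 (Nat.pos_of_ne_zero hn)
  -- Since `μ ∫ kern → n`, the region `‖h‖ < δ` contributes at most about `ε / 4`; the rest carries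
  -- the factor `μ → 0`.
  obtain ⟨δ₀, hδ₀, hRδ₀⟩ := hR0 (ε / (4 * n)) (by positivity)
  obtain ⟨δ, hδ, hδ1, hRδ⟩ : ∃ δ : ℝ, 0 < δ ∧ δ ≤ 1 ∧
      ∀ h, ‖h‖ < δ → |R h| ≤ ε / (4 * n) * (‖h‖ * ‖h‖) :=
    ⟨min δ₀ 1, by positivity, min_le_right _ _, fun h hh => hRδ₀ h (hh.trans_le (min_le_left _ _))⟩
  have hlim := ((tendsto_mu_mul_integral_kern hn).const_mul (ε / (4 * n))).add
    ((tendsto_mu hn).mul_const (|C| * δ⁻¹ * ∫ h, kern n (1 / 2) h))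
  have hlt : ε / (4 * n) * n + 0 * (|C| * δ⁻¹ * ∫ h, kern n (1 / 2) h) < ε := by
    have : ε / (4 * n) * n = ε / 4 := by field_simp
    rw [this]; linarith
  filter_upwards [hlim.eventually (gt_mem_nhds hlt), Ioo_mem_nhdsLT_one one_half_lt_one]
    with α h1 hα
  have hα' : α ∈ Set.Ioo (0 : ℝ) 1 := ⟨by linarith [hα.1], hα.2⟩
  have hk := (integrable_kern hn hα').1
  have hk2 := (integrable_kern hn (α := 1 / 2) ⟨by norm_num, by norm_num⟩).1
  have hmu := mu_nonneg n hα'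
  rw [dist_zero_right, norm_mul, Real.norm_of_nonneg hmu]
  refine lt_of_le_of_lt ?_ h1
  have hb : ‖∫ h, R h / ‖h‖ ^ ((n : ℝ) + α + 1)‖ ≤
      ∫ h, (ε / (4 * n) * kern n α h + |C| * δ⁻¹ * kern n (1 / 2) h) := by
    refine norm_integral_le_of_norm_le ((hk.const_mul _).add (hk2.const_mul _))
      (Eventually.of_forall fun h => ?_)
    rw [norm_div, Real.norm_eq_abs, Real.norm_of_nonneg (Real.rpow_nonneg (norm_nonneg h) _)]
    rcases lt_or_ge ‖h‖ δ with hh | hh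
    · have : |R h| / ‖h‖ ^ ((n : ℝ) + α + 1) ≤ ε / (4 * n) * kern n α h := by
        rw [kern, min_eq_right (hh.le.trans hδ1), ← mul_div_assoc]
        gcongr
        exact hRδ h hh
      have h0 : 0 ≤ |C| * δ⁻¹ * kern n (1 / 2) h :=
        mul_nonneg (by positivity) (kern_nonneg _ _ _)
      linarith
    · have : |R h| / ‖h‖ ^ ((n : ℝ) + α + 1) ≤ |C| * kern n α h := by
        rw [kern, ← mul_div_assoc]
        gcongr
        exact (hR h).trans (mul_le_mul_of_nonneg_right (le_abs_self C) (by positivity))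
      have h2 := mul_le_mul_of_nonneg_left (kern_le_of_le_norm hα hδ hδ1 hh) (abs_nonneg C)
      have h0 : 0 ≤ ε / (4 * n) * kern n α h :=
        mul_nonneg (by positivity) (kern_nonneg _ _ _)
      linarith
  rw [integral_add (hk.const_mul _) (hk2.const_mul _), integral_const_mul, integral_const_mul] at hb
  calc _ ≤ _ := mul_le_mul_of_nonneg_left hb hmu
    _ = _ := by ring

/-- Fractional second differences converge to the trace of the second-order part at the origin. -/
theorem tendsto_mu_mul_integral {n : ℕ} (hn : n ≠ 0) {F : E n → ℝ} {C : ℝ}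
    (M : Fin n → Fin n → ℝ) (hFm : Measurable F)
    (hF : ∀ h, |F h| ≤ C * (min 1 ‖h‖ * ‖h‖))
    (hF0 : ∀ ε > 0, ∃ δ > 0, ∀ h : E n, ‖h‖ < δ →
      |F h - ∑ i, ∑ j, M i j * (h i * h j)| ≤ ε * (‖h‖ * ‖h‖)) :
    Tendsto (fun α => mu n α * ∫ h, F h / ‖h‖ ^ ((n : ℝ) + α + 1)) (𝓝[<] (1 : ℝ))
      (𝓝 (∑ i, M i i)) := by
  let Q : E n → ℝ := fun h => ∑ i, ∑ j, M i j * (h i * h j)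
  -- The quadratic part is cut off at the unit ball: uncut, it would exceed the linear growth
  -- allowed to the remainder at infinity.
  let QB : E n → ℝ := (Metric.ball (0 : E n) 1).indicator Q
  have hQ : ∀ h : E n, |Q h| ≤ (∑ i, ∑ j, |M i j|) * (‖h‖ * ‖h‖) := by
    intro h
    rw [Finset.sum_mul]
    refine (Finset.abs_sum_le_sum_abs _ _).trans (Finset.sum_le_sum fun i _ => ?_)
    rw [Finset.sum_mul]
    refine (Finset.abs_sum_le_sum_abs _ _).trans (Finset.sum_le_sum fun j _ => ?_)
    rw [abs_mul, abs_mul]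
    gcongr <;> exact abs_coord_le _ _
  have hQB : ∀ h : E n, |QB h| ≤ (∑ i, ∑ j, |M i j|) * (min 1 ‖h‖ * ‖h‖) := by
    intro h
    by_cases hh : h ∈ Metric.ball (0 : E n) 1
    · have := hQ h
      rw [mem_ball_zero_iff] at hh
      rw [min_eq_right hh.le]
      simpa [QB, hh] using this
    · simp only [QB, Set.indicator_of_notMem hh, abs_zero]
      positivity
  have hQm : Measurable Q := by fun_prop
  have hQBm : Measurable QB := hQm.indicator measurableSet_ball
  have key := tendsto_mu_mul_integral_zero hn (R := fun h => F h - QB h)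
    (C := C + ∑ i, ∑ j, |M i j|)
    (fun h => by
      rw [add_mul]
      exact (abs_sub _ _).trans (add_le_add (hF h) (hQB h)))
    (fun ε hε => by
      obtain ⟨δ, hδ, h⟩ := hF0 ε hε
      refine ⟨min δ 1, by positivity, fun x hx => ?_⟩
      have : QB x = Q x :=
        Set.indicator_of_mem (mem_ball_zero_iff.2 (hx.trans_le (min_le_right _ _))) _
      rw [this]
      exact h x (hx.trans_le (min_le_left _ _)))
  have hsum := key.add (tendsto_mu_mul_quadratic hn M)
  rw [zero_add] at hsum
  refine hsum.congr' ?_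
  filter_upwards [Ioo_mem_nhdsLT_one zero_lt_one] with α hα
  have hint : ∀ {H : E n → ℝ} {D : ℝ}, Measurable H → (∀ h, |H h| ≤ D * (min 1 ‖h‖ * ‖h‖)) →
      Integrable (fun h => H h / ‖h‖ ^ ((n : ℝ) + α + 1)) := by
    intro H D hHm hH
    refine ((integrable_kern hn hα).1.const_mul D).mono'
      (Measurable.aestronglyMeasurable (by fun_prop)) (Eventually.of_forall fun h => ?_)
    rw [norm_div, Real.norm_eq_abs, Real.norm_of_nonneg (Real.rpow_nonneg (norm_nonneg h) _),
      kern, ← mul_div_assoc]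
    gcongr
    exact hH h
  have e : ∫ h in Metric.ball (0 : E n) 1, Q h / ‖h‖ ^ ((n : ℝ) + α + 1) =
      ∫ h, QB h / ‖h‖ ^ ((n : ℝ) + α + 1) := by
    rw [← integral_indicator measurableSet_ball]
    congr 1; ext h
    by_cases hh : h ∈ Metric.ball (0 : E n) 1 <;> simp [QB, hh]
  change _ * _ + _ * (∫ h in Metric.ball (0 : E n) 1, Q h / ‖h‖ ^ ((n : ℝ) + α + 1)) = _
  rw [e, ← mul_add, ← integral_add _ (hint hQBm hQB)]
  · congr 2; ext h; ring
  · simp_rw [sub_div]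
    exact (hint hFm hF).sub (hint hQBm hQB)

/-! ### Differences of a `W^{1,∞}` function along segments -/

theorem locallyIntegrable_of_bound {n : ℕ} {F : Type*} [NormedAddCommGroup F] {u : E n → F}
    {A : ℝ} (hu : AEStronglyMeasurable u volume) (hA : ∀ᵐ x, ‖u x‖ ≤ A) :
    LocallyIntegrable u volume :=
  (memLp_top_of_bound hu A hA).locallyIntegrable le_top

/-- Fields of fixed direction `h` reduce the weak gradient identity to a scalar one for the
derivative along `h`. -/
theorem div_smul_const {n : ℕ} {ψ : E n → ℝ} (hψ : Differentiable ℝ ψ) (h x : E n) :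
    div (fun y => ψ y • h) x = fderiv ℝ ψ x h := by
  have hd : ∀ v, fderiv ℝ (fun y => ψ y • h) x v = fderiv ℝ ψ x v • h := by
    intro v
    rw [fderiv_smul_const (hψ x)]
    rfl
  simp only [div, hd, PiLp.smul_apply, smul_eq_mul]
  have : h = ∑ i, h i • EuclideanSpace.single i (1 : ℝ) := by
    ext j
    simp [Finset.sum_apply, Pi.single_apply]
  conv_rhs => rw [this, map_sum]
  simp [mul_comm]

theorem isTestField_smul_const {n : ℕ} {ψ : E n → ℝ} (hψ : ContDiff ℝ ∞ ψ)
    (hc : HasCompactSupport ψ) (h : E n) : IsTestField fun x => ψ x • h :=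
  ⟨hψ.smul contDiff_const, hc.smul_right⟩

/-- A shear whose slices are translations; it supplies the joint integrability behind each Fubini
swap along segments. -/
theorem measurePreserving_line {n : ℕ} (h : E n) :
    MeasurePreserving (fun p : ℝ × E n => (p.1, p.2 + p.1 • h))
      ((volume.restrict (Set.Ioc 0 1)).prod volume) ((volume.restrict (Set.Ioc 0 1)).prod volume) :=
  (MeasurePreserving.id (volume.restrict (Set.Ioc (0 : ℝ) 1))).skew_product
    (g := fun (t : ℝ) (x : E n) => x + t • h) (by fun_prop)
    (Eventually.of_forall fun t => (measurePreserving_add_right volume (t • h)).map_eq)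

theorem integrable_line {n : ℕ} {F : Type*} [NormedAddCommGroup F] {u : E n → F}
    (hu : Integrable u) (h : E n) :
    Integrable (fun p : ℝ × E n => u (p.2 + p.1 • h))
      ((volume.restrict (Set.Ioc 0 1)).prod volume) :=
  (measurePreserving_line h).integrable_comp_of_integrable (hu.comp_snd _)

/-- Bounded measurable representatives of a function in `W^{1,∞}` and of its weak gradient. -/
structure IsBddGradPair {n : ℕ} (A : ℝ) (f : E n → ℝ) (g : E n → E n) : Prop where
  meas_fun : Measurable f
  meas_grad : Measurable g
  fun_le : ∀ x, |f x| ≤ A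
  grad_le : ∀ x, ‖g x‖ ≤ A
  weak : HasWeakGrad f g

variable {n : ℕ} {A : ℝ} {f : E n → ℝ} {g : E n → E n}

theorem IsBddGradPair.nonneg (hfg : IsBddGradPair A f g) : 0 ≤ A :=
  (norm_nonneg _).trans (hfg.grad_le 0)

theorem IsBddGradPair.measurable_line (hfg : IsBddGradPair A f g) (h : E n) :
    Measurable fun p : ℝ × E n => ⟪g (p.2 + p.1 • h), h⟫_ℝ :=
  (hfg.meas_grad.comp (by fun_prop)).inner measurable_const

theorem IsBddGradPair.norm_line_le (hfg : IsBddGradPair A f g) (h y : E n) :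
    ‖⟪g y, h⟫_ℝ‖ ≤ A * ‖h‖ :=
  (norm_inner_le_norm _ _).trans (mul_le_mul_of_nonneg_right (hfg.grad_le y) (norm_nonneg h))

theorem IsBddGradPair.norm_line_integral_le (hfg : IsBddGradPair A f g) (h x : E n) :
    ‖∫ t in Set.Ioc (0 : ℝ) 1, ⟪g (x + t • h), h⟫_ℝ‖ ≤ A * ‖h‖ := by
  refine (norm_setIntegral_le_of_norm_le_const (by simp)
    (fun t _ => hfg.norm_line_le h (x + t • h))).trans_eq ?_
  simp [Measure.real]

theorem sub_eq_line_integral {ψ : E n → ℝ} (hψ : ContDiff ℝ ∞ ψ) (x h : E n) :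
    ψ (x + h) - ψ x = ∫ t in Set.Ioc (0 : ℝ) 1, fderiv ℝ ψ (x + t • h) h := by
  have hder : ∀ t : ℝ, HasDerivAt (fun t : ℝ => ψ (x + t • h)) (fderiv ℝ ψ (x + t • h) h) t := by
    intro t
    have h1 : HasDerivAt (fun t : ℝ => x + t • h) h t := by
      simpa using ((hasDerivAt_id t).smul_const h).const_add x
    exact ((hψ.differentiable (by simp)) (x + t • h)).hasFDerivAt.comp_hasDerivAt t h1
  have hcont : Continuous fun t : ℝ => fderiv ℝ ψ (x + t • h) h :=
    ((hψ.continuous_fderiv (by simp)).comp (by fun_prop)).clm_apply continuous_const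
  rw [← intervalIntegral.integral_of_le zero_le_one,
    intervalIntegral.integral_eq_sub_of_hasDerivAt (fun t _ => hder t)
      (hcont.intervalIntegrable _ _)]
  simp

theorem integral_mul_comp_add (u : E n → ℝ) (ψ : E n → ℝ) (k : E n) :
    ∫ x, u (x + k) * ψ x = ∫ x, u x * ψ (x - k) := by
  rw [← integral_add_right_eq_self (fun x => u x * ψ (x - k)) k]
  simp

theorem IsBddGradPair.integral_div_shift (hfg : IsBddGradPair A f g) {ψ : E n → ℝ}
    (hψ : ContDiff ℝ ∞ ψ) (hc : HasCompactSupport ψ) (h k : E n) :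
    ∫ x, f x * fderiv ℝ ψ (x + k) h = -∫ x, ⟪g x, h⟫_ℝ * ψ (x + k) := by
  have hs : ContDiff ℝ ∞ fun x => ψ (x + k) := hψ.comp (contDiff_id.add contDiff_const)
  have hcs : HasCompactSupport fun x => ψ (x + k) :=
    hc.comp_homeomorph (Homeomorph.addRight k)
  have := hfg.weak.2 _ (isTestField_smul_const hs hcs h)
  simp_rw [div_smul_const (hs.differentiable (by simp)), fderiv_comp_add_right,
    real_inner_smul_right] at this
  rw [this]
  simp_rw [mul_comm]

/-- A function with bounded weak gradient is, up to a null set, the integral of its gradient along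
the segments in a given direction. -/
theorem IsBddGradPair.sub_ae_eq (hfg : IsBddGradPair A f g) (h : E n) :
    ∀ᵐ x, f (x + h) - f x = ∫ t in Set.Ioc (0 : ℝ) 1, ⟪g (x + t • h), h⟫_ℝ := by
  have hm1 : Measurable fun x => f (x + h) - f x :=
    (hfg.meas_fun.comp (measurable_add_const h)).sub hfg.meas_fun
  have hm2 : StronglyMeasurable fun x => ∫ t in Set.Ioc (0 : ℝ) 1, ⟪g (x + t • h), h⟫_ℝ :=
    (hfg.measurable_line h).stronglyMeasurable.integral_prod_left'
  refine ae_eq_of_integral_contDiff_smul_eq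
    (locallyIntegrable_of_bound (A := A + A) hm1.aestronglyMeasurable
      (Eventually.of_forall fun x => (abs_sub _ _).trans (add_le_add (hfg.fun_le _) (hfg.fun_le _))))
    (locallyIntegrable_of_bound hm2.aestronglyMeasurable
      (Eventually.of_forall (hfg.norm_line_integral_le h))) fun ψ hψ hc => ?_
  have hψi : Integrable ψ := hψ.continuous.integrable_of_hasCompactSupport hc
  have hbf : ∀ {u : E n → ℝ}, Integrable u → Integrable fun x => f x * u x := fun hu =>
    hu.bdd_mul hfg.meas_fun.aestronglyMeasurable (Eventually.of_forall hfg.fun_le)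
  have hDi : Integrable fun x => fderiv ℝ ψ x h := by
    refine ((hψ.continuous_fderiv (by simp)).clm_apply
      continuous_const).integrable_of_hasCompactSupport ?_
    exact (hc.fderiv ℝ).comp_left (g := fun L : E n →L[ℝ] ℝ => L h) (by simp)
  -- The increment is `-h` because translating `f` by `h` amounts to translating `ψ` by `-h`.
  have hF1 : Integrable (fun p : ℝ × E n => f p.2 * fderiv ℝ ψ (p.2 + p.1 • (-h)) (-h))
      ((volume.restrict (Set.Ioc 0 1)).prod volume) := by
    have := integrable_line hDi.neg (-h)
    refine (this.bdd_mul (c := A) (hfg.meas_fun.comp measurable_snd).aestronglyMeasurable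
      (Eventually.of_forall fun p => hfg.fun_le p.2)).congr (Eventually.of_forall fun p => ?_)
    simp
  have hF2 : Integrable (fun p : ℝ × E n => ψ p.2 * ⟪g (p.2 + p.1 • h), h⟫_ℝ)
      ((volume.restrict (Set.Ioc 0 1)).prod volume) :=
    (hψi.comp_snd _).mul_bdd (hfg.measurable_line h).aestronglyMeasurable
      (Eventually.of_forall fun p => hfg.norm_line_le h _)
  -- By duality the difference falls on the smooth `ψ`, where the fundamental theorem of calculus
  -- applies; after Fubini, the weak gradient identity is used at each fixed `t` and the translation
  -- is undone.
  calc ∫ x, ψ x • (f (x + h) - f x)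
      = (∫ x, f (x + h) * ψ x) - ∫ x, f x * ψ x := by
        rw [← integral_sub _ (hbf hψi)]
        · congr 1; ext x; rw [smul_eq_mul]; ring
        · exact hψi.bdd_mul (hfg.meas_fun.comp (measurable_add_const h)).aestronglyMeasurable
            (Eventually.of_forall fun x => hfg.fun_le (x + h))
    _ = ∫ x, f x * (ψ (x + -h) - ψ x) := by
        rw [integral_mul_comp_add, ← integral_sub (hbf (hψi.comp_sub_right h)) (hbf hψi)]
        congr 1; ext x; rw [← sub_eq_add_neg]; ring
    _ = ∫ x, ∫ t in Set.Ioc (0 : ℝ) 1, f x * fderiv ℝ ψ (x + t • (-h)) (-h) := by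
        congr 1; ext x
        rw [sub_eq_line_integral hψ, integral_const_mul]
    _ = ∫ t in Set.Ioc (0 : ℝ) 1, ∫ x, f x * fderiv ℝ ψ (x + t • (-h)) (-h) :=
        (integral_integral_swap hF1).symm
    _ = ∫ t in Set.Ioc (0 : ℝ) 1, ∫ x, ψ x * ⟪g (x + t • h), h⟫_ℝ := by
        congr 1; ext t
        rw [hfg.integral_div_shift hψ hc]
        have := integral_mul_comp_add (fun x => ⟪g x, h⟫_ℝ) ψ (t • h)
        simp_rw [mul_comm (ψ _), this, inner_neg_right, neg_mul, integral_neg, neg_neg, smul_neg,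
          ← sub_eq_add_neg]
    _ = ∫ x, ∫ t in Set.Ioc (0 : ℝ) 1, ψ x * ⟪g (x + t • h), h⟫_ℝ :=
        integral_integral_swap hF2
    _ = _ := by
        congr 1; ext x
        rw [integral_const_mul, smul_eq_mul]

theorem IsBddGradPair.abs_sub_le (hfg : IsBddGradPair A f g) (h : E n) :
    ∀ᵐ x, |f (x + h) - f x| ≤ 2 * A * min 1 ‖h‖ := by
  filter_upwards [hfg.sub_ae_eq h] with x hx
  have hA := hfg.nonneg
  rcases le_total 1 ‖h‖ with hh | hh
  · rw [min_eq_left hh]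
    linarith [abs_sub (f (x + h)) (f x), hfg.fun_le (x + h), hfg.fun_le x]
  · rw [min_eq_right hh, hx]
    have := hfg.norm_line_integral_le h x
    rw [Real.norm_eq_abs] at this
    nlinarith [mul_nonneg hA (norm_nonneg h)]

end FracSobolev

/-! ### The singular integral is the weak fractional gradient -/

namespace FracSobolev

/-- The singular integral defining the fractional gradient of a bounded Lipschitz function. -/
noncomputable def fracGrad {n : ℕ} (α : ℝ) (f : E n → ℝ) (x : E n) : E n :=
  mu n α • ∫ h : E n, ((f (x + h) - f x) / ‖h‖ ^ ((n : ℝ) + α + 1)) • h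

/-- The first difference of `f` in direction `h`, paired with the component of `φ` along `h`. -/
noncomputable def diffPairing {n : ℕ} (f : E n → ℝ) (φ : E n → E n) (h : E n) : ℝ :=
  ∫ x, (f (x + h) - f x) * ⟪h, φ x⟫_ℝ

variable {n : ℕ} {A α : ℝ} {f : E n → ℝ} {g φ : E n → E n}

theorem measurable_diff (hf : Measurable f) :
    Measurable fun p : E n × E n => f (p.2 + p.1) - f p.2 :=
  (hf.comp (by fun_prop)).sub (hf.comp measurable_snd)

/-- The null set in `abs_sub_le` depends on `h`. Joint measurability merges these sets into one null
set of pairs, which can then be sliced at fixed `x`, as the singular integral requires. -/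
theorem IsBddGradPair.ae_prod (hfg : IsBddGradPair A f g) :
    ∀ᵐ p : E n × E n ∂(volume.prod volume),
      |f (p.2 + p.1) - f p.2| ≤ 2 * A * min 1 ‖p.1‖ := by
  have hm : MeasurableSet {p : E n × E n | |f (p.2 + p.1) - f p.2| ≤ 2 * A * min 1 ‖p.1‖} :=
    measurableSet_le (by simpa only [Real.norm_eq_abs] using (measurable_diff hfg.meas_fun).norm)
      (by fun_prop)
  exact (Measure.ae_prod_iff_ae_ae hm).2 (Eventually.of_forall hfg.abs_sub_le)

theorem IsBddGradPair.ae_ae (hfg : IsBddGradPair A f g) :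
    ∀ᵐ x : E n, ∀ᵐ h : E n, |f (x + h) - f x| ≤ 2 * A * min 1 ‖h‖ :=
  Measure.ae_ae_of_ae_prod (Measure.measurePreserving_swap.quasiMeasurePreserving.ae hfg.ae_prod)

theorem norm_quotient_smul_le {B a : ℝ} {h : E n} (ha : |a| ≤ B * min 1 ‖h‖) :
    ‖(a / ‖h‖ ^ ((n : ℝ) + α + 1)) • h‖ ≤ B * kern n α h := by
  rw [norm_smul, norm_div, Real.norm_eq_abs,
    Real.norm_of_nonneg (Real.rpow_nonneg (norm_nonneg h) _), kern, div_mul_eq_mul_div,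
    ← mul_div_assoc, ← mul_assoc]
  gcongr

theorem IsBddGradPair.integrable_quotient (hfg : IsBddGradPair A f g) (hn : n ≠ 0)
    (hα : α ∈ Set.Ioo (0 : ℝ) 1) :
    ∀ᵐ x : E n, Integrable fun h : E n =>
      ((f (x + h) - f x) / ‖h‖ ^ ((n : ℝ) + α + 1)) • h := by
  filter_upwards [hfg.ae_ae] with x hx
  have hm : Measurable fun h : E n => ((f (x + h) - f x) / ‖h‖ ^ ((n : ℝ) + α + 1)) • h := by
    have := hfg.meas_fun
    fun_prop
  exact ((integrable_kern hn hα).1.const_mul (2 * A)).mono' hm.aestronglyMeasurable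
    (hx.mono fun h hh => norm_quotient_smul_le hh)

theorem IsBddGradPair.norm_fracGrad_le (hfg : IsBddGradPair A f g) (hn : n ≠ 0)
    (hα : α ∈ Set.Ioo (0 : ℝ) 1) :
    ∀ᵐ x : E n, ‖fracGrad α f x‖ ≤ mu n α * (2 * A * ∫ h, kern n α h) := by
  filter_upwards [hfg.ae_ae] with x hx
  rw [fracGrad, norm_smul, Real.norm_of_nonneg (mu_nonneg n hα), ← integral_const_mul]
  refine mul_le_mul_of_nonneg_left ?_ (mu_nonneg n hα)
  exact norm_integral_le_of_norm_le ((integrable_kern hn hα).1.const_mul _)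
    (hx.mono fun h hh => norm_quotient_smul_le hh)

theorem stronglyMeasurable_fracGrad (hf : Measurable f) : StronglyMeasurable (fracGrad α f) := by
  have hm : Measurable fun p : E n × E n =>
      ((f (p.1 + p.2) - f p.1) / ‖p.2‖ ^ ((n : ℝ) + α + 1)) • p.2 := by fun_prop
  exact hm.stronglyMeasurable.integral_prod_right'.const_smul (mu n α)

theorem IsBddGradPair.memLp_fracGrad (hfg : IsBddGradPair A f g) (hn : n ≠ 0)
    (hα : α ∈ Set.Ioo (0 : ℝ) 1) : MemLp (fracGrad α f) ∞ volume :=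
  memLp_top_of_bound (stronglyMeasurable_fracGrad hfg.meas_fun).aestronglyMeasurable _
    (hfg.norm_fracGrad_le hn hα)

/-- Fubini for the pairing of the singular integral with an integrable field. -/
theorem IsBddGradPair.integral_inner_fracGrad (hfg : IsBddGradPair A f g) (hn : n ≠ 0)
    (hα : α ∈ Set.Ioo (0 : ℝ) 1) (hφm : Measurable φ) (hφ : Integrable φ) :
    ∫ x, ⟪fracGrad α f x, φ x⟫_ℝ =
      mu n α * ∫ h, diffPairing f φ h / ‖h‖ ^ ((n : ℝ) + α + 1) := by
  let K : E n → E n → ℝ := fun h x =>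
    ⟪φ x, ((f (x + h) - f x) / ‖h‖ ^ ((n : ℝ) + α + 1)) • h⟫_ℝ
  have hKm : Measurable (Function.uncurry K) := by
    have := hfg.meas_fun
    unfold K Function.uncurry
    fun_prop
  have hKi : Integrable (Function.uncurry K) (volume.prod volume) := by
    refine (((integrable_kern hn hα).1.const_mul (2 * A)).mul_prod hφ.norm).mono'
      hKm.aestronglyMeasurable ?_
    filter_upwards [hfg.ae_prod] with p hp
    refine (norm_inner_le_norm _ _).trans ?_
    rw [mul_comm]
    exact mul_le_mul_of_nonneg_right (norm_quotient_smul_le hp) (norm_nonneg _)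
  calc ∫ x, ⟪fracGrad α f x, φ x⟫_ℝ = ∫ x, mu n α * ∫ h, K h x := by
        refine integral_congr_ae ?_
        filter_upwards [hfg.integrable_quotient hn hα] with x hx
        rw [fracGrad, real_inner_smul_left, real_inner_comm, integral_inner hx]
    _ = mu n α * ∫ h, ∫ x, K h x := by
        rw [integral_const_mul, integral_integral_swap hKi]
    _ = _ := by
        congr 2; ext h
        rw [diffPairing, ← integral_div]
        congr 1; ext x
        simp only [K, real_inner_smul_right, real_inner_comm (φ x) h]
        ring

theorem fracDiv_eq (x : E n) :
    fracDiv α φ x = mu n α * ∫ h : E n, ⟪h, φ (x + h) - φ x⟫_ℝ / ‖h‖ ^ ((n : ℝ) + α + 1) := by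
  rw [fracDiv, ← integral_add_left_eq_self _ x]
  simp

/-- First differences of a test field are dominated, uniformly in the increment, by an integrable
function and its translate. -/
theorem IsTestField.exists_diff_bound (hφ : IsTestField φ) :
    ∃ P : E n → ℝ, Integrable P ∧ (∀ x, 0 ≤ P x) ∧
      ∀ x h, ‖φ (x + h) - φ x‖ ≤ min 1 ‖h‖ * (P x + ‖φ (x + h)‖) := by
  obtain ⟨L, hL⟩ := ContDiff.lipschitzWith_of_hasCompactSupport hφ.2 hφ.1 (by simp)
  obtain ⟨R, hR⟩ := hφ.2.isBounded.subset_closedBall 0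
  have hout : ∀ y, R < ‖y‖ → φ y = 0 := fun y hy => by
    by_contra hne
    have := hR (subset_tsupport _ hne)
    rw [mem_closedBall_zero_iff] at this
    linarith
  have hind : ∀ x, 0 ≤ (Metric.closedBall (0 : E n) (R + 1)).indicator (fun _ => (L : ℝ)) x :=
    fun x => Set.indicator_nonneg (fun _ _ => L.2) x
  -- The radius `R + 1` ensures that, when `‖x‖ > R + 1` and `‖h‖ ≤ 1`, both `x` and `x + h` lie
  -- outside the support.
  refine ⟨fun x => (Metric.closedBall (0 : E n) (R + 1)).indicator (fun _ => (L : ℝ)) x + ‖φ x‖,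
    ?_, fun x => add_nonneg (hind x) (norm_nonneg _), fun x h => ?_⟩
  · refine Integrable.add ?_ (hφ.1.continuous.integrable_of_hasCompactSupport hφ.2).norm
    exact (integrable_indicator_iff measurableSet_closedBall).2
      (integrableOn_const measure_closedBall_lt_top.ne)
  · rcases le_total 1 ‖h‖ with hh | hh
    · rw [min_eq_left hh, one_mul]
      have := norm_sub_le (φ (x + h)) (φ x)
      linarith [hind x]
    · rw [min_eq_right hh]
      beta_reduce
      by_cases hx : ‖x‖ ≤ R + 1
      · have h1 : ‖φ (x + h) - φ x‖ ≤ L * ‖h‖ := by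
          simpa [dist_eq_norm] using hL.dist_le_mul (x + h) x
        rw [Set.indicator_of_mem (mem_closedBall_zero_iff.2 hx)]
        nlinarith [mul_nonneg (norm_nonneg h) (norm_nonneg (φ x)),
          mul_nonneg (norm_nonneg h) (norm_nonneg (φ (x + h)))]
      · push Not at hx
        have h2 := norm_sub_le (x + h) h
        rw [add_sub_cancel_right] at h2
        rw [hout x (by linarith), hout (x + h) (by linarith), sub_zero, norm_zero]
        exact mul_nonneg (norm_nonneg h) (add_nonneg (add_nonneg (hind x) le_rfl) le_rfl)

/-- Discrete integration by parts: translation by `-h` carries the difference from `φ` to `f`. The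
two minus signs come from the increment, now `-h`, in the pairing. -/
theorem integral_mul_inner_diff (hf : Measurable f) (hfA : ∀ x, |f x| ≤ A) (hφ : Integrable φ)
    (h : E n) : ∫ x, f x * ⟪h, φ (x + h) - φ x⟫_ℝ = -diffPairing f φ (-h) := by
  have hi : ∀ {u : E n → ℝ} {ψ : E n → E n}, Measurable u → (∀ x, |u x| ≤ A) → Integrable ψ →
      Integrable fun x => u x * ⟪h, ψ x⟫_ℝ := fun hu huA hψ =>
    (hψ.const_inner h).bdd_mul hu.aestronglyMeasurable (Eventually.of_forall huA)
  have h1 := integral_mul_comp_add f (fun x => ⟪h, φ x⟫_ℝ) (-h)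
  simp only [sub_neg_eq_add] at h1
  simp_rw [diffPairing, inner_neg_left, inner_sub_right, mul_sub, mul_neg, sub_mul, integral_neg,
    neg_neg]
  rw [integral_sub (hi hf hfA (hφ.comp_add_right h)) (hi hf hfA hφ),
    integral_sub (hi (u := fun x => f (x + -h)) (hf.comp (measurable_add_const (-h)))
      (fun x => hfA _) hφ) (hi hf hfA hφ), h1]

theorem IsBddGradPair.hasWeakFracGrad (hfg : IsBddGradPair A f g) (hn : n ≠ 0)
    (hα : α ∈ Set.Ioo (0 : ℝ) 1) : HasWeakFracGrad α f (fracGrad α f) := by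
  refine ⟨(hfg.memLp_fracGrad hn hα).locallyIntegrable le_top, fun φ hφ => ?_⟩
  have hφc := hφ.1.continuous
  have hφi : Integrable φ := hφc.integrable_of_hasCompactSupport hφ.2
  obtain ⟨P, hPi, hP0, hP⟩ := hφ.exists_diff_bound
  let K : E n → E n → ℝ := fun h x =>
    f x * (⟪h, φ (x + h) - φ x⟫_ℝ / ‖h‖ ^ ((n : ℝ) + α + 1))
  have hKm : Measurable (Function.uncurry K) := by
    have h1 := hfg.meas_fun
    have h2 := hφc.measurable
    unfold K Function.uncurry
    fun_prop
  -- A product of integrable functions composed with the measure-preserving shear `(h, x) ↦ (h, h +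
  -- x)`.
  have hdom : Integrable (fun p : E n × E n => kern n α p.1 * ‖φ (p.1 + p.2)‖)
      (volume.prod volume) :=
    (measurePreserving_prod_add volume volume).integrable_comp_of_integrable
      (g := fun p : E n × E n => kern n α p.1 * ‖φ p.2‖)
      ((integrable_kern hn hα).1.mul_prod hφi.norm)
  have hKi : Integrable (Function.uncurry K) (volume.prod volume) := by
    refine ((((integrable_kern hn hα).1.mul_prod hPi).add hdom).const_mul A).mono'
      hKm.aestronglyMeasurable (Eventually.of_forall fun ⟨h, x⟩ => ?_)
    simp only [Function.uncurry_apply_pair, K, norm_mul, norm_div, Pi.add_apply,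
      Real.norm_of_nonneg (Real.rpow_nonneg (norm_nonneg h) _)]
    refine mul_le_mul (hfg.fun_le x) ?_ (by positivity) hfg.nonneg
    rw [← mul_add, kern, div_mul_eq_mul_div]
    refine div_le_div_of_nonneg_right ?_ (Real.rpow_nonneg (norm_nonneg h) _)
    refine (norm_inner_le_norm _ _).trans ?_
    have := mul_le_mul_of_nonneg_left (hP x h) (norm_nonneg h)
    rw [add_comm h x]
    linarith
  rw [hfg.integral_inner_fracGrad hn hα hφc.measurable hφi]
  calc ∫ x, f x * fracDiv α φ x = mu n α * ∫ x, ∫ h, K h x := by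
        rw [← integral_const_mul]
        congr 1; ext x
        rw [fracDiv_eq, integral_const_mul]; ring
    _ = mu n α * ∫ h, ∫ x, K h x := by rw [integral_integral_swap hKi]
    -- The reflection `h ↦ -h` preserves both the measure and the kernel, leaving only the sign of
    -- the weak identity.
    _ = mu n α * ∫ h : E n, -(diffPairing f φ (-h) / ‖-h‖ ^ ((n : ℝ) + α + 1)) := by
        congr 2; ext h
        simp_rw [K, ← mul_div_assoc]
        rw [integral_div, integral_mul_inner_diff hfg.meas_fun hfg.fun_le hφi, norm_neg, neg_div]
    _ = _ := by
        rw [integral_neg,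
          integral_neg_eq_self (fun h : E n => diffPairing f φ h / ‖h‖ ^ ((n : ℝ) + α + 1)),
          mul_neg]

end FracSobolev

/-! ### The limit `α → 1` of the pairings -/

namespace FracSobolev

variable {n : ℕ} {A α : ℝ} {f : E n → ℝ} {g φ : E n → E n}

/-- Continuity of translations in `L¹`. -/
theorem tendsto_integral_norm_translate (hφ : Integrable φ) :
    Tendsto (fun k : E n => ∫ x, ‖φ (x + k) - φ x‖) (𝓝 0) (𝓝 0) := by
  have hm : MemLp φ 1 volume := memLp_one_iff_integrable.2 hφ
  have : Fact ((1 : ℝ≥0∞) ≠ ⊤) := ⟨ENNReal.one_ne_top⟩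
  have hc : Continuous fun k : E n => DomAddAct.mk k +ᵥ hm.toLp φ :=
    (DomAddAct.continuous_mk).vadd continuous_const
  have h0 := (continuous_iff_continuousAt.1 (hc.dist (continuous_const (y := hm.toLp φ)))) 0
  have he : ∀ k : E n, dist (DomAddAct.mk k +ᵥ hm.toLp φ) (hm.toLp φ) =
      ∫ x, ‖φ (x + k) - φ x‖ := by
    intro k
    rw [L1.dist_eq_integral_dist]
    refine integral_congr_ae ?_
    filter_upwards [DomAddAct.vadd_Lp_ae_eq (DomAddAct.mk k) (hm.toLp φ), hm.coeFn_toLp,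
      (measurePreserving_add_left volume k).quasiMeasurePreserving.ae hm.coeFn_toLp] with x h1 h2 h3
    rw [h1, h2, dist_eq_norm]
    simp only [Equiv.symm_apply_apply, vadd_eq_add, h3]
    rw [add_comm k x]
  simp_rw [ContinuousAt, he] at h0
  simpa using h0

theorem IsBddGradPair.integrable_line_mul (hfg : IsBddGradPair A f g) (hφ : Integrable φ) (h : E n) :
    Integrable (fun p : ℝ × E n => ⟪g (p.2 + p.1 • h), h⟫_ℝ * ⟪h, φ p.2⟫_ℝ)
      ((volume.restrict (Set.Ioc 0 1)).prod volume) :=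
  ((hφ.const_inner (𝕜 := ℝ) h).comp_snd (volume.restrict (Set.Ioc (0 : ℝ) 1))).bdd_mul
    (hfg.measurable_line h).aestronglyMeasurable (Eventually.of_forall fun _ => hfg.norm_line_le h _)

/-- The translation is moved from `g`, which is merely bounded, to `φ`, where translations are
continuous in `L¹`. -/
theorem IsBddGradPair.diffPairing_eq (hfg : IsBddGradPair A f g) (hφ : Integrable φ) (h : E n) :
    diffPairing f φ h =
      ∫ t in Set.Ioc (0 : ℝ) 1, ∫ x, ⟪g x, h⟫_ℝ * ⟪h, φ (x - t • h)⟫_ℝ := by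
  calc diffPairing f φ h
      = ∫ x, ∫ t in Set.Ioc (0 : ℝ) 1, ⟪g (x + t • h), h⟫_ℝ * ⟪h, φ x⟫_ℝ := by
        refine integral_congr_ae ?_
        filter_upwards [hfg.sub_ae_eq h] with x hx
        rw [hx, integral_mul_const]
    _ = ∫ t in Set.Ioc (0 : ℝ) 1, ∫ x, ⟪g (x + t • h), h⟫_ℝ * ⟪h, φ x⟫_ℝ :=
        (integral_integral_swap (hfg.integrable_line_mul hφ h)).symm
    _ = _ := by
        congr 1; ext t
        exact integral_mul_comp_add (fun x => ⟪g x, h⟫_ℝ) (fun x => ⟪h, φ x⟫_ℝ) (t • h)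

theorem IsBddGradPair.integrable_mul_inner (hfg : IsBddGradPair A f g) (hφ : Integrable φ)
    (h : E n) : Integrable fun x => ⟪g x, h⟫_ℝ * ⟪h, φ x⟫_ℝ :=
  (hφ.const_inner h).bdd_mul (hfg.meas_grad.inner measurable_const).aestronglyMeasurable
    (Eventually.of_forall fun _ => hfg.norm_line_le h _)

/-- Replacing `φ (x - t • h)` by `φ x` costs at most `A ‖h‖²` times the `L¹` modulus of continuity
of `φ`. This is the second-order expansion of the pairing at the origin. -/
theorem IsBddGradPair.abs_diffPairing_sub_le (hfg : IsBddGradPair A f g) (hφ : Integrable φ)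
    {ε δ : ℝ} (hδ : ∀ k : E n, ‖k‖ < δ → ∫ x, ‖φ (x + k) - φ x‖ ≤ ε) {h : E n} (hh : ‖h‖ < δ) :
    |diffPairing f φ h - ∫ x, ⟪g x, h⟫_ℝ * ⟪h, φ x⟫_ℝ| ≤ A * ε * (‖h‖ * ‖h‖) := by
  have h1 : ∀ t ∈ Set.Ioc (0 : ℝ) 1,
      ‖(∫ x, ⟪g x, h⟫_ℝ * ⟪h, φ (x - t • h)⟫_ℝ) - ∫ x, ⟪g x, h⟫_ℝ * ⟪h, φ x⟫_ℝ‖ ≤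
        A * ε * (‖h‖ * ‖h‖) := by
    intro t ht
    have hk : ‖-(t • h)‖ < δ := by
      rw [norm_neg, norm_smul, Real.norm_of_nonneg ht.1.le]
      nlinarith [ht.2, norm_nonneg h]
    have hs : Integrable fun x => φ (x - t • h) := hφ.comp_sub_right (t • h)
    rw [← integral_sub (hfg.integrable_mul_inner hs h) (hfg.integrable_mul_inner hφ h)]
    have hd := (hs.sub hφ).norm
    refine (norm_integral_le_of_norm_le (hd.const_mul (A * (‖h‖ * ‖h‖)))
      (Eventually.of_forall fun x => ?_)).trans ?_
    · rw [← mul_sub, ← inner_sub_right, norm_mul]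
      calc _ ≤ (A * ‖h‖) * (‖h‖ * ‖φ (x - t • h) - φ x‖) :=
            mul_le_mul (hfg.norm_line_le h x) (norm_inner_le_norm _ _) (norm_nonneg _)
              (mul_nonneg hfg.nonneg (norm_nonneg _))
        _ = _ := by simp only [Pi.sub_apply]; ring
    · rw [integral_const_mul]
      have := hδ _ hk
      simp only [← sub_eq_add_neg] at this
      calc _ ≤ A * (‖h‖ * ‖h‖) * ε :=
            mul_le_mul_of_nonneg_left this (mul_nonneg hfg.nonneg (by positivity))
        _ = _ := by ring
  have hsw := (hfg.integrable_line_mul hφ h).integral_prod_left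
  have hsw' : Integrable (fun t : ℝ => ∫ x, ⟪g x, h⟫_ℝ * ⟪h, φ (x - t • h)⟫_ℝ)
      (volume.restrict (Set.Ioc 0 1)) := by
    refine hsw.congr (Eventually.of_forall fun t => ?_)
    exact integral_mul_comp_add (fun x => ⟪g x, h⟫_ℝ) (fun x => ⟪h, φ x⟫_ℝ) (t • h)
  have hc : ∫ x, ⟪g x, h⟫_ℝ * ⟪h, φ x⟫_ℝ =
      ∫ _ in Set.Ioc (0 : ℝ) 1, ∫ x, ⟪g x, h⟫_ℝ * ⟪h, φ x⟫_ℝ := by simp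
  rw [hfg.diffPairing_eq hφ, hc, ← integral_sub hsw' (integrable_const _), ← Real.norm_eq_abs]
  refine (norm_setIntegral_le_of_norm_le_const (by simp) h1).trans_eq ?_
  simp [Measure.real]

theorem IsBddGradPair.abs_diffPairing_le (hfg : IsBddGradPair A f g) (hφ : Integrable φ)
    (h : E n) : |diffPairing f φ h| ≤ 2 * A * (∫ x, ‖φ x‖) * (min 1 ‖h‖ * ‖h‖) := by
  have := norm_integral_le_of_norm_le (f := fun x => (f (x + h) - f x) * ⟪h, φ x⟫_ℝ)
    (hφ.norm.const_mul (2 * A * min 1 ‖h‖ * ‖h‖)) (by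
      filter_upwards [hfg.abs_sub_le h] with x hx
      rw [norm_mul]
      calc _ ≤ (2 * A * min 1 ‖h‖) * (‖h‖ * ‖φ x‖) :=
            mul_le_mul hx (norm_inner_le_norm _ _) (norm_nonneg _) ((abs_nonneg _).trans hx)
        _ = _ := by ring)
  rw [integral_const_mul] at this
  rw [diffPairing, ← Real.norm_eq_abs]
  refine this.trans_eq ?_
  ring

theorem measurable_diffPairing (hf : Measurable f) (hφ : Measurable φ) :
    Measurable (diffPairing f φ) := by
  have hm : Measurable fun p : E n × E n => (f (p.2 + p.1) - f p.2) * ⟪p.1, φ p.2⟫_ℝ := by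
    fun_prop
  exact hm.stronglyMeasurable.integral_prod_right'.measurable

theorem IsBddGradPair.integrable_coord_mul (hfg : IsBddGradPair A f g) (hφ : Integrable φ)
    (i j : Fin n) : Integrable fun x => g x i * φ x j := by
  have hg : Measurable fun x => g x i := by have := hfg.meas_grad; fun_prop
  have hφj : Integrable fun x => φ x j := by
    refine (hφ.const_inner (𝕜 := ℝ) (EuclideanSpace.single j (1 : ℝ))).congr
      (Eventually.of_forall fun x => ?_)
    simp [EuclideanSpace.inner_single_left]
  exact hφj.bdd_mul hg.aestronglyMeasurable
    (Eventually.of_forall fun x => (abs_coord_le _ i).trans (hfg.grad_le x))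

theorem IsBddGradPair.tendsto_integral_fracGrad (hfg : IsBddGradPair A f g) (hn : n ≠ 0)
    (hφm : Measurable φ) (hφ : Integrable φ) :
    Tendsto (fun α => ∫ x, ⟪fracGrad α f x, φ x⟫_ℝ) (𝓝[<] (1 : ℝ)) (𝓝 (∫ x, ⟪g x, φ x⟫_ℝ)) := by
  let M : Fin n → Fin n → ℝ := fun i j => ∫ x, g x i * φ x j
  have htr : ∫ x, ⟪g x, φ x⟫_ℝ = ∑ i, M i i := by
    rw [← integral_finsetSum _ fun i _ => hfg.integrable_coord_mul hφ i i]
    congr 1; ext x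
    simp [PiLp.inner_apply, mul_comm]
  have hQ : ∀ h : E n, ∫ x, ⟪g x, h⟫_ℝ * ⟪h, φ x⟫_ℝ = ∑ i, ∑ j, M i j * (h i * h j) := by
    intro h
    simp only [M, ← integral_mul_const]
    have hi : ∀ i j, Integrable fun x => g x i * φ x j * (h i * h j) :=
      fun i j => (hfg.integrable_coord_mul hφ i j).mul_const _
    simp_rw [← integral_finsetSum _ fun j _ => hi _ j]
    rw [← integral_finsetSum _ fun i _ => integrable_finsetSum _ fun j _ => hi i j]
    congr 1; ext x
    simp only [PiLp.inner_apply, Finset.sum_mul_sum, RCLike.inner_apply, conj_trivial]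
    refine Finset.sum_congr rfl fun i _ => Finset.sum_congr rfl fun j _ => ?_
    ring
  rw [htr]
  refine (tendsto_mu_mul_integral hn M (measurable_diffPairing hfg.meas_fun hφm)
    (hfg.abs_diffPairing_le hφ) fun ε hε => ?_).congr' ?_
  · have hA : 0 < A + 1 := by linarith [hfg.nonneg]
    have ht := (tendsto_integral_norm_translate hφ).eventually
      (gt_mem_nhds (show (0 : ℝ) < ε / (A + 1) by positivity))
    obtain ⟨δ, hδ, h⟩ := Metric.eventually_nhds_iff.1 ht
    refine ⟨δ, hδ, fun k hk => ?_⟩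
    rw [← hQ]
    refine (hfg.abs_diffPairing_sub_le hφ (ε := ε / (A + 1)) (δ := δ)
      (fun k hk => (h (by simpa using hk)).le) hk).trans ?_
    refine mul_le_mul_of_nonneg_right ?_ (by positivity)
    rw [mul_div_assoc', div_le_iff₀ hA]
    nlinarith
  · filter_upwards [Ioo_mem_nhdsLT_one zero_lt_one] with α hα
    rw [hfg.integral_inner_fracGrad hn hα hφm hφ]

end FracSobolev

/-! ### Representatives, uniqueness and weak* lower semicontinuity -/

namespace FracSobolev

variable {n : ℕ} {α : ℝ} {f f' : E n → ℝ} {g g' : E n → E n}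

/-- A measurable version is set to zero where its norm exceeds the essential supremum, which happens
only on a null set. -/
theorem exists_bdd_measurable_rep {F : Type*} [NormedAddCommGroup F] [MeasurableSpace F]
    [BorelSpace F] {u : E n → F} (hu : MemLp u ∞ volume) :
    ∃ (v : E n → F) (A : ℝ), Measurable v ∧ u =ᵐ[volume] v ∧ ∀ x, ‖v x‖ ≤ A := by
  let w := hu.1.mk u
  have hw : Measurable w := hu.1.stronglyMeasurable_mk.measurable
  let A : ℝ := (eLpNormEssSup u volume).toReal
  have hS : MeasurableSet {x | ‖w x‖ ≤ A} := measurableSet_le hw.norm measurable_const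
  refine ⟨{x | ‖w x‖ ≤ A}.indicator w, A, hw.indicator hS, ?_, fun x => ?_⟩
  · have hfin : eLpNormEssSup u volume ≠ ⊤ := by
      simpa [eLpNorm_exponent_top] using hu.2.ne
    filter_upwards [hu.1.ae_eq_mk, ae_le_eLpNormEssSup (f := u) (μ := volume)] with x hx hle
    have : x ∈ {x | ‖w x‖ ≤ A} := by
      change ‖hu.1.mk u x‖ ≤ A
      rw [← hx, ← toReal_enorm]
      exact ENNReal.toReal_mono hfin hle
    rw [Set.indicator_of_mem this]
    exact hx
  · by_cases hx : x ∈ {x | ‖w x‖ ≤ A}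
    · rw [Set.indicator_of_mem hx]; exact hx
    · rw [Set.indicator_of_notMem hx, norm_zero]; exact ENNReal.toReal_nonneg

theorem HasWeakGrad.congr (h : HasWeakGrad f g) (hf : f =ᵐ[volume] f') (hg : g =ᵐ[volume] g') :
    HasWeakGrad f' g' := by
  refine ⟨h.1.congr hg, fun φ hφ => ?_⟩
  have h1 : ∫ x, f' x * div φ x = ∫ x, f x * div φ x :=
    integral_congr_ae (hf.mono fun x hx => by simp only [hx])
  have h2 : ∫ x, ⟪g' x, φ x⟫_ℝ = ∫ x, ⟪g x, φ x⟫_ℝ :=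
    integral_congr_ae (hg.mono fun x hx => by simp only [hx])
  rw [h1, h2, h.2 φ hφ]

theorem HasWeakFracGrad.congr_fun (h : HasWeakFracGrad α f g) (hf : f =ᵐ[volume] f') :
    HasWeakFracGrad α f' g := by
  refine ⟨h.1, fun φ hφ => ?_⟩
  have h1 : ∫ x, f' x * fracDiv α φ x = ∫ x, f x * fracDiv α φ x :=
    integral_congr_ae (hf.mono fun x hx => by simp only [hx])
  rw [h1, h.2 φ hφ]

/-- A locally integrable field is determined by its pairings with test fields. -/
theorem ae_eq_of_integral_inner_testField (hg : LocallyIntegrable g volume)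
    (hg' : LocallyIntegrable g' volume)
    (h : ∀ φ : E n → E n, IsTestField φ → ∫ x, ⟪g x, φ x⟫_ℝ = ∫ x, ⟪g' x, φ x⟫_ℝ) :
    g =ᵐ[volume] g' := by
  refine ae_eq_of_integral_contDiff_smul_eq hg hg' fun ψ hψ hc => ?_
  refine ext_inner_left ℝ fun v => ?_
  rw [← integral_inner (hg.integrable_smul_left_of_hasCompactSupport hψ.continuous hc),
    ← integral_inner (hg'.integrable_smul_left_of_hasCompactSupport hψ.continuous hc)]
  have := h _ (isTestField_smul_const hψ hc v)
  simpa only [real_inner_smul_right, real_inner_comm v] using this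

theorem HasWeakGrad.ae_eq (h : HasWeakGrad f g) (h' : HasWeakGrad f g') : g =ᵐ[volume] g' :=
  ae_eq_of_integral_inner_testField h.1 h'.1 fun φ hφ =>
    neg_injective ((h.2 φ hφ).symm.trans (h'.2 φ hφ))

theorem HasWeakFracGrad.ae_eq (h : HasWeakFracGrad α f g) (h' : HasWeakFracGrad α f g') :
    g =ᵐ[volume] g' :=
  ae_eq_of_integral_inner_testField h.1 h'.1 fun φ hφ =>
    neg_injective ((h.2 φ hφ).symm.trans (h'.2 φ hφ))

theorem MemW1.exists_bddGradPair (hf : MemW1 ∞ f) :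
    ∃ (A : ℝ) (f' : E n → ℝ) (g' : E n → E n), f =ᵐ[volume] f' ∧ IsBddGradPair A f' g' := by
  obtain ⟨hf1, g, hg, hg1⟩ := hf
  obtain ⟨f', A, hfm, hff, hfA⟩ := exists_bdd_measurable_rep hf1
  obtain ⟨g', B, hgm, hgg, hgB⟩ := exists_bdd_measurable_rep hg1
  exact ⟨max A B, f', g', hff, hfm, hgm, fun x => (hfA x).trans (le_max_left _ _),
    fun x => (hgB x).trans (le_max_right _ _), hg.congr hff hgg⟩

/-- Duality bound: a bounded field whose pairing with `L¹` is controlled by `r` is bounded by `r`. -/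
theorem ae_norm_le_of_integral_inner_le {A r : ℝ} (hgm : Measurable g) (hgA : ∀ x, ‖g x‖ ≤ A)
    (h : ∀ φ : E n → E n, Measurable φ → Integrable φ → ∫ x, ⟪g x, φ x⟫_ℝ ≤ r * ∫ x, ‖φ x‖)
    (hr : 0 ≤ r) : ∀ᵐ x, ‖g x‖ ≤ r := by
  have hint : ∀ s : Set (E n), volume s < ⊤ → IntegrableOn (fun x => ‖g x‖) s := fun s hs =>
    Measure.integrableOn_of_bounded hs.ne hgm.norm.aestronglyMeasurable
      (M := A) (Eventually.of_forall fun x => by simpa using hgA x)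
  have key : 0 ≤ᵐ[volume] fun x => r - ‖g x‖ := by
    refine ae_nonneg_of_forall_setIntegral_nonneg_of_sigmaFinite
      (fun s _ hs => (integrableOn_const hs.ne).sub (hint s hs)) fun s hsm hs => ?_
    -- The unit direction of `g` on `s`, so that the pairing is `∫ ‖g‖` over `s`. Where `g`
    -- vanishes, `‖g x‖⁻¹` is `0` and so is `φ`.
    let φ : E n → E n := s.indicator fun x => ‖g x‖⁻¹ • g x
    have hφm : Measurable φ := (hgm.norm.inv.smul hgm).indicator hsm
    have hφ1 : ∀ x, ‖φ x‖ ≤ s.indicator (fun _ => (1 : ℝ)) x := by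
      intro x
      by_cases hx : x ∈ s
      · simp only [φ, Set.indicator_of_mem hx, norm_smul, norm_inv, norm_norm]
        exact inv_mul_le_one
      · simp [φ, hx]
    have hone : Integrable (s.indicator fun _ => (1 : ℝ)) :=
      (integrable_indicator_iff hsm).2 (integrableOn_const hs.ne)
    have hφi : Integrable φ := hone.mono' hφm.aestronglyMeasurable (Eventually.of_forall hφ1)
    have h1 := h φ hφm hφi
    have h2 : ∫ x, ⟪g x, φ x⟫_ℝ = ∫ x in s, ‖g x‖ := by
      rw [← integral_indicator hsm]
      congr 1; ext x
      by_cases hx : x ∈ s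
      · simp only [φ, Set.indicator_of_mem hx, real_inner_smul_right,
          real_inner_self_eq_norm_mul_norm]
        by_cases h0 : ‖g x‖ = 0
        · simp [h0]
        · field_simp
      · simp [φ, hx]
    have h3 : ∫ x, ‖φ x‖ ≤ ∫ x, s.indicator (fun _ => (1 : ℝ)) x :=
      integral_mono hφi.norm hone hφ1
    rw [integral_indicator hsm] at h3
    have hri : IntegrableOn (fun _ : E n => r) s := integrableOn_const hs.ne
    rw [integral_sub hri (hint s hs), ← h2]
    have h4 : ∫ _ in s, r = r * ∫ _ in s, (1 : ℝ) := by rw [← integral_const_mul, mul_one]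
    rw [h4]
    have := mul_le_mul_of_nonneg_left h3 hr
    linarith
  exact key.mono fun x hx => sub_nonneg.1 hx

theorem integral_inner_le_of_ae_norm_le {φ u : E n → E n} {r : ℝ} (hφ : Integrable φ)
    (hu : ∀ᵐ x, ‖u x‖ ≤ r) : ∫ x, ⟪u x, φ x⟫_ℝ ≤ r * ∫ x, ‖φ x‖ := by
  rw [← integral_const_mul]
  refine (Real.le_norm_self _).trans (norm_integral_le_of_norm_le (hφ.norm.const_mul r) ?_)
  filter_upwards [hu] with x hx
  exact (norm_inner_le_norm _ _).trans (mul_le_mul_of_nonneg_right hx (norm_nonneg _))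

/-- Weak* lower semicontinuity of the `L^∞` norm. -/
theorem eLpNorm_top_le_liminf {A : ℝ} {G : ℝ → E n → E n} {l : Filter ℝ} (hgm : Measurable g)
    (hgA : ∀ x, ‖g x‖ ≤ A)
    (h : ∀ φ : E n → E n, Measurable φ → Integrable φ →
      Tendsto (fun α => ∫ x, ⟪G α x, φ x⟫_ℝ) l (𝓝 (∫ x, ⟪g x, φ x⟫_ℝ))) :
    eLpNorm g ∞ volume ≤ liminf (fun α => eLpNorm (G α) ∞ volume) l := by
  refine le_of_forall_gt_imp_ge_of_dense fun r hr => ?_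
  rcases eq_or_ne r ∞ with rfl | hrt
  · exact le_top
  -- Above the liminf, the norms are below `r` only frequently, not eventually; this suffices to
  -- pass an upper bound on convergent pairings to the limit.
  have hfreq : ∃ᶠ α in l, eLpNorm (G α) ∞ volume < r :=
    frequently_lt_of_liminf_lt (by isBoundedDefault) hr
  have hle : ∀ᵐ x, ‖g x‖ ≤ r.toReal := by
    refine ae_norm_le_of_integral_inner_le hgm hgA (fun φ hφm hφ => ?_) ENNReal.toReal_nonneg
    refine le_of_tendsto_of_frequently (h φ hφm hφ) (hfreq.mono fun α hα => ?_)
    refine integral_inner_le_of_ae_norm_le hφ ?_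
    rw [eLpNorm_exponent_top] at hα
    filter_upwards [ae_le_eLpNormEssSup (f := G α) (μ := volume)] with x hx
    rw [← toReal_enorm]
    exact ENNReal.toReal_mono hrt (hx.trans hα.le)
  refine (eLpNorm_le_of_ae_bound hle).trans ?_
  simp [ENNReal.ofReal_toReal hrt]

/-! ### Assembly, with dimension zero apart -/

theorem memS_top (hf : MemW1 ∞ f) (hn : n ≠ 0) (hα : α ∈ Set.Ioo (0 : ℝ) 1) : MemS α ∞ f := by
  obtain ⟨A, f', g', hff, hfg⟩ := hf.exists_bddGradPair
  exact ⟨hf.1, fracGrad α f', (hfg.hasWeakFracGrad hn hα).congr_fun hff.symm,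
    hfg.memLp_fracGrad hn hα⟩

/-- Polar coordinates need `n ≥ 1`. On the one-point space every vector field vanishes, so the zero
field is a fractional gradient. -/
theorem memS_zero {f : E 0 → ℝ} (hf : MemLp f ∞ volume) : MemS α ∞ f := by
  refine ⟨hf, 0, ⟨locallyIntegrable_zero, fun φ _ => ?_⟩, MemLp.zero⟩
  have : ∀ x, fracDiv α φ x = 0 := fun x => by
    simp [fracDiv, Subsingleton.elim (φ _) 0]
  simp [this]

theorem tendstoWeakStar_and_le_liminf (hf : MemW1 ∞ f) (hn : n ≠ 0) {G : ℝ → E n → E n}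
    (hg : HasWeakGrad f g) (hG : ∀ α ∈ Set.Ioo (0 : ℝ) 1, HasWeakFracGrad α f (G α)) :
    TendstoWeakStarLInfty G (𝓝[<] (1 : ℝ)) g ∧
      eLpNorm g ∞ volume ≤ liminf (fun α : ℝ => eLpNorm (G α) ∞ volume) (𝓝[<] (1 : ℝ)) := by
  obtain ⟨A, f', g', hff, hfg⟩ := hf.exists_bddGradPair
  have hgg : g =ᵐ[volume] g' := hg.ae_eq (hfg.weak.congr hff.symm EventuallyEq.rfl)
  have hGG : ∀ α ∈ Set.Ioo (0 : ℝ) 1, G α =ᵐ[volume] fracGrad α f' := fun α hα =>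
    (hG α hα).ae_eq ((hfg.hasWeakFracGrad hn hα).congr_fun hff.symm)
  have hlim : ∀ φ : E n → E n, Integrable φ →
      Tendsto (fun α => ∫ x, ⟪G α x, φ x⟫_ℝ) (𝓝[<] (1 : ℝ)) (𝓝 (∫ x, ⟪g' x, φ x⟫_ℝ)) := by
    intro φ hφ
    -- The Fubini argument is stated for measurable fields, so `φ` is replaced by a measurable
    -- version; `G α` becomes the singular integral by uniqueness of weak fractional gradients.
    have hφφ := hφ.1.ae_eq_mk
    have hm := hφ.1.stronglyMeasurable_mk.measurable
    have e1 : ∫ x, ⟪g' x, φ x⟫_ℝ = ∫ x, ⟪g' x, hφ.1.mk φ x⟫_ℝ :=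
      integral_congr_ae (hφφ.mono fun x hx => by simp only [← hx])
    rw [e1]
    refine (hfg.tendsto_integral_fracGrad hn hm (hφ.congr hφφ)).congr' ?_
    filter_upwards [Ioo_mem_nhdsLT_one zero_lt_one] with α hα
    refine integral_congr_ae ?_
    filter_upwards [hφφ, hGG α hα] with x h1 h2
    rw [h2, ← h1]
  refine ⟨⟨?_, ?_, fun φ hφ => ?_⟩, ?_⟩
  · filter_upwards [Ioo_mem_nhdsLT_one zero_lt_one] with α hα
    exact (hfg.memLp_fracGrad hn hα).ae_eq (hGG α hα).symm
  · exact (memLp_top_of_bound hfg.meas_grad.aestronglyMeasurable A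
      (Eventually.of_forall hfg.grad_le)).ae_eq hgg.symm
  · have e : ∫ x, ⟪g x, φ x⟫_ℝ = ∫ x, ⟪g' x, φ x⟫_ℝ :=
      integral_congr_ae (hgg.mono fun x hx => by simp only [hx])
    rw [e]
    exact hlim φ (memLp_one_iff_integrable.1 hφ)
  · rw [eLpNorm_congr_ae hgg]
    exact eLpNorm_top_le_liminf hfg.meas_grad hfg.grad_le fun φ _ hφ => hlim φ hφ

end FracSobolev

theorem mainTheorem6 (n : ℕ) (f : FracSobolev.E n → ℝ) (hf : FracSobolev.MemW1 ∞ f) :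
    (∀ α ∈ Set.Ioo (0 : ℝ) 1, FracSobolev.MemS α ∞ f) ∧
    ∀ (g : FracSobolev.E n → FracSobolev.E n) (G : ℝ → FracSobolev.E n → FracSobolev.E n),
      FracSobolev.HasWeakGrad f g →
      (∀ α ∈ Set.Ioo (0 : ℝ) 1, FracSobolev.HasWeakFracGrad α f (G α)) →
      FracSobolev.TendstoWeakStarLInfty G (𝓝[<] (1 : ℝ)) g ∧
      eLpNorm g ∞ volume ≤ liminf (fun α : ℝ => eLpNorm (G α) ∞ volume) (𝓝[<] (1 : ℝ)) := by
  rcases eq_or_ne n 0 with rfl | hn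
  · refine ⟨fun α _ => FracSobolev.memS_zero hf.1, fun g G _ _ => ?_⟩
    obtain rfl : g = 0 := Subsingleton.elim _ _
    obtain rfl : G = 0 := Subsingleton.elim _ _
    refine ⟨⟨Eventually.of_forall fun _ => MemLp.zero, MemLp.zero, fun φ _ => ?_⟩, by simp⟩
    simp
  · exact ⟨fun α hα => FracSobolev.memS_top hf hn hα, fun g G hg hG =>
      FracSobolev.tendstoWeakStar_and_le_liminf hf hn hg hG⟩
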